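/- **Definitions.** A bornology on a set $X$ is a family $\mathcal B$ of subsets of $X$ (the bounded sets) that contains $\emptyset$ and all singletons and is closed under subsets and finite unions. A coarse proximity space $(X,\mathcal B,\mathbf b)$ is a set $X$ with a bornology $\mathcal B$ and a relation $\mathbf b$ on the power set of $X$ such that, for all $A,B,C\subseteq X$: (1) $A\,\mathbf b\,B$ implies $B\,\mathbf b\,A$; (2) $A\,\mathbf b\,B$ implies $A,B\notin\mathcal B$; (3) $A\cap B\notin\mathcal B$ implies $A\,\mathbf b\,B$; (4) $(A\cup B)\,\mathbf b\,C$ if and only if $A\,\mathbf b\,C$ or $B\,\mathbf b\,C$; (5) if $A\,\mathbf b\,B$ fails, then there is $E\subseteq X$ such that $A\,\mathbf b\,E$ and $(X\setminus E)\,\mathbf b\,B$ both fail. A coarse proximity map is a function $f:X\to Y$ that takes bounded sets to bounded sets and satisfies $A\,\mathbf b_X\,B\Rightarrow f(A)\,\mathbf b_Y\,f(B)$. Write $A\,\delta_X\,B$ if $A\cap B\neq\emptyset$ or $A\,\mathbf b\,B$; this is a proximity relation on $X$. A cluster is a nonempty family $\sigma$ of subsets of $X$ such that: $A\,\delta_X\,B$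 for all $A,B\in\sigma$; $A\cup B\in\sigma$ implies $A\in\sigma$ or $B\in\sigma$; and if $C\,\delta_X\,A$ for all $A\in\sigma$, then $C\in\sigma$. The set $\mathfrak X$ of clusters (the Smirnov compactification of $(X,\delta_X)$) carries the proximity $\delta_X^*$ defined as follows: $\mathcal S\,\delta_X^*\,\mathcal T$ if and only if $A\,\delta_X\,B$ whenever $A$ belongs to every $\sigma\in\mathcal S$ and $B$ belongs to every $\tau\in\mathcal T$. Its topology has the closure operator $\operatorname{cl}(\mathcal S)=\{\sigma\mid\{\sigma\}\,\delta_X^*\,\mathcal S\}$. The boundary $\mathcal UX\subseteq\mathfrak X$ is the subspace of those clusters that contain no bounded set. A coarse proximity map $f:X\to Y$ induces $\mathcal Uf:\mathcal UX\to\mathcal UY$, $$\mathcal Uf(\sigma)=\{D\subseteq Y\mid D\,\delta_Y\,f(E)\text{ for all }E\in\sigma\}.$$ **Theorem.** Let $\Omega$ be a nonempty directed partially ordered set, and let $\{(X_\alpha,\mathcal B_\alpha,\mathbf b_\alpha),f_{\beta\alpha}\}$ be an inverse system of coarse proximity spaces over $\Omega$: for all $\alpha<\beta$, $f_{\beta\alpha}:X_\beta\to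 X_\alpha$ is a coarse proximity map, and $f_{\beta\alpha}\circ f_{\gamma\beta}=f_{\gamma\alpha}$ for $\alpha<\beta<\gamma$. Let $Z=\{(x_\alpha)\in\prod_\alpha X_\alpha\mid f_{\beta\alpha}(x_\beta)=x_\alpha\text{ for all }\alpha<\beta\}$ be its set-theoretic inverse limit, with projections $\pi_\alpha:Z\to X_\alpha$, and suppose that every $\pi_\alpha$ is surjective. Equip $Z$ with the inverse limit coarse proximity structure: $B\subseteq Z$ is bounded if and only if $\pi_\alpha(B)\in\mathcal B_\alpha$ for some $\alpha\in\Omega$, and $A\,\mathbf b\,C$ if and only if $\pi_\alpha(A)\,\mathbf b_\alpha\,\pi_\alpha(C)$ for all $\alpha\in\Omega$. Then the spaces $\mathcal UX_\alpha$ and the maps $\mathcal Uf_{\beta\alpha}$ form an inverse system of topological spaces and continuous maps, and $\mathcal UZ$, with the maps $\mathcal U\pi_\alpha$, is its inverse limit. That is, the map $$\mathcal UZ\to\Big\{(\sigma_\alpha)\in\prod_\alpha\mathcal UX_\alpha\ \Big|\ \mathcal Uf_{\beta\alpha}(\sigma_\beta)=\sigma_\alpha\text{ for all }\alpha<\beta\Big\},\qquad\sigma\mapsto(\mathcal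 U\pi_\alpha(\sigma))_\alpha,$$ is a homeomorphism, where the right-hand side has the subspace topology of the product topology. -/

import Mathlib

open Set Bornology

universe u v

/-! ### Proximity spaces, clusters and the Smirnov compactification -/

/-- A proximity relation on (the power set of) `X`. -/
structure ProximityRel (X : Type u) where
  near : Set X → Set X → Prop
  not_near_empty : ∀ A, ¬ near A ∅
  symm : ∀ {A B}, near A B → near B A
  near_of_inter : ∀ {A B}, (A ∩ B).Nonempty → near A B
  near_union : ∀ {A B C}, near A (B ∪ C) ↔ near A B ∨ near A C
  strong : ∀ {A B}, ¬ near A B → ∃ E, ¬ near A Eᶜ ∧ ¬ near E B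

namespace ProximityRel

variable {X : Type u} {Y : Type v}

theorem mono_right (P : ProximityRel X) {A B C : Set X} (h : P.near A B) (hBC : B ⊆ C) :
    P.near A C := by
  rw [← union_eq_self_of_subset_left hBC]
  exact P.near_union.2 (Or.inl h)

theorem mono_left (P : ProximityRel X) {A B C : Set X} (h : P.near A B) (hAC : A ⊆ C) :
    P.near C B :=
  P.symm (P.mono_right (P.symm h) hAC)

/-- The topology induced by a proximity relation: the closure of `A` is `{x | {x} δ A}`, so a set
is closed when it contains every point near it. -/
abbrev topology (P : ProximityRel X) : TopologicalSpace X where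
  IsOpen U := ∀ x ∈ U, ¬ P.near {x} Uᶜ
  isOpen_univ := by
    intro x _
    rw [compl_univ]
    exact P.not_near_empty _
  isOpen_inter := by
    intro U V hU hV x hx h
    rw [compl_inter] at h
    exact (P.near_union.1 h).elim (hU x hx.1) (hV x hx.2)
  isOpen_sUnion := by
    intro S hS x hx h
    obtain ⟨U, hUS, hxU⟩ := hx
    exact hS U hUS x hxU
      (P.mono_right h (compl_subset_compl.2 (subset_sUnion_of_mem hUS)))

/-- Clusters of a proximity space. -/
@[ext]
structure Cluster (P : ProximityRel X) where
  sets : Set (Set X)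
  nonempty : sets.Nonempty
  near_of_mem : ∀ {A B}, A ∈ sets → B ∈ sets → P.near A B
  mem_or_mem : ∀ {A B}, A ∪ B ∈ sets → A ∈ sets ∨ B ∈ sets
  mem_of_near : ∀ {C}, (∀ A ∈ sets, P.near C A) → C ∈ sets

theorem Cluster.mem_of_subset {P : ProximityRel X} (σ : P.Cluster) {A B : Set X}
    (hA : A ∈ σ.sets) (hAB : A ⊆ B) : B ∈ σ.sets :=
  σ.mem_of_near fun _ hD => P.mono_left (σ.near_of_mem hA hD) hAB

theorem Cluster.mem_or_compl_mem {P : ProximityRel X} (σ : P.Cluster) (A : Set X) :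
    A ∈ σ.sets ∨ Aᶜ ∈ σ.sets := by
  obtain ⟨B, hB⟩ := σ.nonempty
  apply σ.mem_or_mem
  rw [union_compl_self]
  exact σ.mem_of_subset hB (subset_univ B)

/-- `A` absorbs a collection of clusters when it belongs to all of them. -/
def Absorbs (P : ProximityRel X) (A : Set X) (S : Set P.Cluster) : Prop :=
  ∀ σ ∈ S, A ∈ σ.sets

/-- The proximity `δ*` on the set of clusters: `S δ* T` if and only if `A δ B` for all sets
`A` absorbing `S` and `B` absorbing `T`. -/
def smirnov (P : ProximityRel X) : ProximityRel P.Cluster where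
  near S T := ∀ A B, P.Absorbs A S → P.Absorbs B T → P.near A B
  not_near_empty := by
    intro S h
    refine P.not_near_empty univ (h univ ∅ ?_ ?_)
    · intro σ _
      obtain ⟨B, hB⟩ := σ.nonempty
      exact σ.mem_of_subset hB (subset_univ B)
    · intro σ hσ
      exact hσ.elim
  symm := fun h A B hA hB => P.symm (h B A hB hA)
  near_of_inter := by
    rintro S T ⟨σ, hS, hT⟩ A B hA hB
    exact σ.near_of_mem (hA σ hS) (hB σ hT)
  near_union := by
    intro S T R
    constructor
    · intro h
      by_contra hcon
      simp only [not_or, not_forall] at hcon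
      obtain ⟨⟨A, B, hA, hB, hAB⟩, ⟨A', C, hA', hC, hAC⟩⟩ := hcon
      obtain ⟨E, hE, hE'⟩ := P.strong hAB
      obtain ⟨F, hF, hF'⟩ := P.strong hAC
      have hBC : P.Absorbs (B ∪ C) (T ∪ R) := by
        rintro σ (hσ | hσ)
        · exact σ.mem_of_subset (hB σ hσ) subset_union_left
        · exact σ.mem_of_subset (hC σ hσ) subset_union_right
      have hEF : P.Absorbs (E ∩ F) S := by
        intro σ hσ
        refine (σ.mem_or_compl_mem (E ∩ F)).resolve_right fun hc => ?_
        rw [compl_inter] at hc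
        rcases σ.mem_or_mem hc with hc | hc
        · exact hE (σ.near_of_mem (hA σ hσ) hc)
        · exact hF (σ.near_of_mem (hA' σ hσ) hc)
      rcases P.near_union.1 (h _ _ hEF hBC) with h' | h'
      · exact hE' (P.mono_left h' inter_subset_left)
      · exact hF' (P.mono_left h' inter_subset_right)
    · rintro (h | h) A B hA hB
      · exact h A B hA fun σ hσ => hB σ (Or.inl hσ)
      · exact h A B hA fun σ hσ => hB σ (Or.inr hσ)
  strong := by
    intro S T h
    simp only [not_forall] at h
    obtain ⟨A, B, hA, hB, hAB⟩ := h
    obtain ⟨E, hE, hE'⟩ := P.strong hAB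
    refine ⟨{σ | E ∈ σ.sets}, fun h => hE (h A Eᶜ hA ?_), fun h => hE' (h E B ?_ hB)⟩
    · intro σ hσ
      exact (σ.mem_or_compl_mem E).resolve_left hσ
    · exact fun σ hσ => hσ

/-- The Smirnov compactification: the set of clusters with the topology induced by `δ*`. -/
instance (P : ProximityRel X) : TopologicalSpace P.Cluster :=
  P.smirnov.topology

/-- Proximity maps. -/
def IsProximityMap (P : ProximityRel X) (Q : ProximityRel Y) (f : X → Y) : Prop :=
  ∀ A B, P.near A B → Q.near (f '' A) (f '' B)

/-- The map of Smirnov compactifications induced by a proximity map `f`: it sends a cluster `σ` to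
the associated cluster `{D | D δ f(E) for all E ∈ σ}`. -/
def IsProximityMap.mapCluster {P : ProximityRel X} {Q : ProximityRel Y} {f : X → Y}
    (hf : IsProximityMap P Q f) (σ : P.Cluster) : Q.Cluster where
  sets := {D | ∀ E ∈ σ.sets, Q.near D (f '' E)}
  nonempty := by
    obtain ⟨B, hB⟩ := σ.nonempty
    exact ⟨f '' B, fun E hE => hf _ _ (σ.near_of_mem hB hE)⟩
  near_of_mem := by
    intro A B hA hB
    by_contra hAB
    obtain ⟨E, hE, hE'⟩ := Q.strong hAB
    rcases σ.mem_or_compl_mem (f ⁻¹' E) with h | h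
    · exact hE' (Q.symm (Q.mono_right (hB _ h) (image_preimage_subset f E)))
    · exact hE (Q.mono_right (hA _ h) (image_preimage_subset f Eᶜ))
  mem_or_mem := by
    intro A B h
    by_contra hcon
    simp only [not_or, mem_ofPred_eq, not_forall] at hcon
    obtain ⟨⟨C, hC, hAC⟩, ⟨D, hD, hBD⟩⟩ := hcon
    obtain ⟨E, hE, hE'⟩ := Q.strong hAC
    obtain ⟨F, hF, hF'⟩ := Q.strong hBD
    have hEF : f ⁻¹' (Eᶜ ∩ Fᶜ) ∈ σ.sets := by
      refine (σ.mem_or_compl_mem _).resolve_right fun hc => ?_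
      rw [← preimage_compl, compl_inter, compl_compl, compl_compl, preimage_union] at hc
      rcases σ.mem_or_mem hc with hc | hc
      · exact hE' (Q.mono_left (hf _ _ (σ.near_of_mem hc hC)) (image_preimage_subset f E))
      · exact hF' (Q.mono_left (hf _ _ (σ.near_of_mem hc hD)) (image_preimage_subset f F))
    have h1 := Q.symm (Q.mono_right (h _ hEF) (image_preimage_subset f _))
    rcases Q.near_union.1 h1 with h2 | h2
    · exact hE (Q.symm (Q.mono_left h2 inter_subset_left))
    · exact hF (Q.symm (Q.mono_left h2 inter_subset_right))
  mem_of_near := by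
    intro C hC E hE
    exact hC _ fun E' hE' => hf _ _ (σ.near_of_mem hE hE')

end ProximityRel

/-! ### Coarse proximity spaces and their boundaries -/

/-- A coarse proximity space `(X, 𝓑, b)`; `𝓑` is the family of bounded sets of the bornology. -/
class CoarseProximitySpace (X : Type u) extends Bornology X where
  near : Set X → Set X → Prop
  symm : ∀ {A B}, near A B → near B A
  not_isBounded : ∀ {A B}, near A B → ¬ IsBounded A ∧ ¬ IsBounded B
  near_of_inter : ∀ {A B}, ¬ IsBounded (A ∩ B) → near A B
  union_near : ∀ {A B C}, near (A ∪ B) C ↔ near A C ∨ near B C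
  strong : ∀ {A B}, ¬ near A B → ∃ E, ¬ near A E ∧ ¬ near Eᶜ B

namespace CoarseProximitySpace

variable {X : Type u} {Y : Type v} [CoarseProximitySpace X] [CoarseProximitySpace Y]

theorem near_union {A B C : Set X} : near A (B ∪ C) ↔ near A B ∨ near A C := by
  constructor
  · intro h
    exact (union_near.1 (symm h)).imp symm symm
  · rintro (h | h)
    · exact symm (union_near.2 (Or.inl (symm h)))
    · exact symm (union_near.2 (Or.inr (symm h)))

theorem near_mono_right {A B C : Set X} (h : near A B) (hBC : B ⊆ C) : near A C := by
  rw [← union_eq_self_of_subset_left hBC]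
  exact near_union.2 (Or.inl h)

theorem near_mono {A B A' B' : Set X} (h : near A B) (hA : A ⊆ A') (hB : B ⊆ B') :
    near A' B' :=
  symm (near_mono_right (symm (near_mono_right h hB)) hA)

variable (X) in
/-- The discrete extension of a coarse proximity: `A δ B` if and only if `A ∩ B ≠ ∅` or `A b B`. -/
def discreteExtension : ProximityRel X where
  near A B := (A ∩ B).Nonempty ∨ near A B
  not_near_empty := by
    rintro A (h | h)
    · simp at h
    · exact (not_isBounded h).2 isBounded_empty
  symm := by
    rintro A B (h | h)
    · exact Or.inl (inter_comm A B ▸ h)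
    · exact Or.inr (symm h)
  near_of_inter := Or.inl
  near_union := by
    intro A B C
    rw [inter_union_distrib_left, union_nonempty, near_union]
    tauto
  strong := by
    intro A B h
    rw [not_or, not_nonempty_iff_eq_empty] at h
    obtain ⟨E, hE, hE'⟩ := strong h.2
    refine ⟨(Eᶜ ∩ Bᶜ) ∪ A, ?_, ?_⟩
    · rintro (⟨x, hxA, hx⟩ | h')
      · exact hx (Or.inr hxA)
      · have : ((Eᶜ ∩ Bᶜ) ∪ A)ᶜ ⊆ E ∪ B := by
          intro x hx
          by_contra hc
          exact hx (Or.inl ⟨fun h => hc (Or.inl h), fun h => hc (Or.inr h)⟩)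
        exact (near_union.1 (near_mono_right h' this)).elim hE h.2
    · rintro (⟨x, hx | hx, hxB⟩ | h')
      · exact hx.2 hxB
      · exact (h.1 ▸ (⟨hx, hxB⟩ : x ∈ A ∩ B) : x ∈ (∅ : Set X))
      · rcases union_near.1 h' with h' | h'
        · exact hE' (near_mono h' inter_subset_left subset_rfl)
        · exact h.2 h'

variable (X) in
/-- The boundary `𝓤X`: the clusters of the discrete extension that contain no bounded set, as a
subspace of the Smirnov compactification of the discrete extension. -/
abbrev Boundary : Type u :=
  {σ : (discreteExtension X).Cluster // ∀ B ∈ σ.sets, ¬ IsBounded B}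

end CoarseProximitySpace

open CoarseProximitySpace

/-- Coarse proximity maps (individual functions, not closeness classes). -/
structure CoarseProximityMap (X : Type u) (Y : Type v) [CoarseProximitySpace X]
    [CoarseProximitySpace Y] where
  toFun : X → Y
  isBounded_image : ∀ {B : Set X}, IsBounded B → IsBounded (toFun '' B)
  near_image : ∀ {A B : Set X}, near A B → near (toFun '' A) (toFun '' B)

namespace CoarseProximityMap

variable {X : Type u} {Y : Type v} [CoarseProximitySpace X] [CoarseProximitySpace Y]

theorem isBounded_of_image (f : CoarseProximityMap X Y) {A : Set X}
    (h : IsBounded (f.toFun '' A)) : IsBounded A := by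
  by_contra hA
  have h1 : near A A := near_of_inter (by rwa [inter_self])
  exact (not_isBounded (f.near_image h1)).1 h

theorem isProximityMap (f : CoarseProximityMap X Y) :
    ProximityRel.IsProximityMap (discreteExtension X) (discreteExtension Y) f.toFun := by
  rintro A B (⟨x, hxA, hxB⟩ | h)
  · exact Or.inl ⟨f.toFun x, mem_image_of_mem _ hxA, mem_image_of_mem _ hxB⟩
  · exact Or.inr (f.near_image h)

/-- The induced map `𝓤f : 𝓤X → 𝓤Y`, the restriction to the boundaries of the map of Smirnov
compactifications induced by `f`. -/
def boundaryMap (f : CoarseProximityMap X Y) (σ : Boundary X) : Boundary Y :=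
  ⟨f.isProximityMap.mapCluster σ.1, by
    intro D hD hDb
    obtain ⟨E, hE⟩ := σ.1.nonempty
    have hpre : IsBounded (f.toFun ⁻¹' D) :=
      f.isBounded_of_image (hDb.subset (image_preimage_subset _ _))
    rcases σ.1.mem_or_compl_mem (f.toFun ⁻¹' D) with h | h
    · exact σ.2 _ h hpre
    · rcases hD _ h with ⟨y, hyD, x, hx, rfl⟩ | h'
      · exact hx hyD
      · exact (not_isBounded h').1 hDb⟩

end CoarseProximityMap

/-! ### Inverse systems and inverse limits -/

/-- An inverse system of coarse proximity spaces and coarse proximity maps `X β → X α`, `α < β`. -/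
structure CoarseInverseSystem (Ω : Type u) [PartialOrder Ω] (X : Ω → Type v)
    [∀ α, CoarseProximitySpace (X α)] where
  map : ∀ {α β : Ω}, α < β → CoarseProximityMap (X β) (X α)
  map_comp : ∀ {α β γ : Ω} (hαβ : α < β) (hβγ : β < γ) (x : X γ),
    (map hαβ).toFun ((map hβγ).toFun x) = (map (hαβ.trans hβγ)).toFun x

namespace CoarseInverseSystem

variable {Ω : Type u} [PartialOrder Ω] {X : Ω → Type v} [∀ α, CoarseProximitySpace (X α)]

/-- The set-theoretic inverse limit `Z`. -/
structure Limit (S : CoarseInverseSystem Ω X) where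
  coord : ∀ α, X α
  compat : ∀ {α β : Ω} (h : α < β), (S.map h).toFun (coord β) = coord α

variable (S : CoarseInverseSystem Ω X)

/-- The inverse limit of the boundaries `𝓤(X α)` along the maps `𝓤f`, as a subspace of the product
`∏ α, 𝓤(X α)`. -/
abbrev BoundaryLimit : Type (max u v) :=
  {s : ∀ α, Boundary (X α) // ∀ (α β : Ω) (h : α < β), (S.map h).boundaryMap (s β) = s α}

/-- The projection `π α : Z → X α`. -/
def proj (α : Ω) (z : S.Limit) : X α := z.coord α

theorem map_image_proj {α β : Ω} (h : α < β) (A : Set S.Limit) :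
    (S.map h).toFun '' (S.proj β '' A) = S.proj α '' A := by
  rw [image_image]
  exact image_congr fun z _ => z.compat h

theorem isBounded_proj_iff_of_le {α β : Ω} (h : α ≤ β) (A : Set S.Limit) :
    IsBounded (S.proj β '' A) ↔ IsBounded (S.proj α '' A) := by
  rcases h.eq_or_lt with rfl | h
  · rfl
  · rw [← S.map_image_proj h A]
    exact ⟨(S.map h).isBounded_image, (S.map h).isBounded_of_image⟩

theorem near_proj_of_le {α β : Ω} (h : α ≤ β) {A B : Set S.Limit}
    (hn : near (S.proj β '' A) (S.proj β '' B)) : near (S.proj α '' A) (S.proj α '' B) := by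
  rcases h.eq_or_lt with rfl | h
  · exact hn
  · rw [← S.map_image_proj h A, ← S.map_image_proj h B]
    exact (S.map h).near_image hn

variable [IsDirectedOrder Ω]

theorem isBounded_proj_iff (α β : Ω) (A : Set S.Limit) :
    IsBounded (S.proj α '' A) ↔ IsBounded (S.proj β '' A) := by
  obtain ⟨γ, hα, hβ⟩ := exists_ge_ge α β
  rw [← S.isBounded_proj_iff_of_le hα, S.isBounded_proj_iff_of_le hβ]

variable [Nonempty Ω]

/-- The inverse limit bornology: `B` is bounded if and only if `π α (B)` is bounded for some `α`. -/
instance limitBornology : Bornology S.Limit :=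
  Bornology.ofBounded {B | ∃ α, IsBounded (S.proj α '' B)}
    ⟨Classical.arbitrary Ω, by simp⟩
    (fun _ ⟨α, h⟩ _ hs => ⟨α, h.subset (image_mono hs)⟩)
    (fun _ ⟨α, h⟩ _ ⟨β, h'⟩ => ⟨α, by
      rw [image_union]
      exact h.union ((S.isBounded_proj_iff β α _).1 h')⟩)
    (fun z => ⟨Classical.arbitrary Ω, by simp⟩)

theorem limit_isBounded_iff {B : Set S.Limit} :
    IsBounded B ↔ ∃ α, IsBounded (S.proj α '' B) := by
  exact Bornology.isBounded_ofBounded_iff _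

/-- The inverse limit coarse proximity structure on `Z`: `A b C` if and only if
`π α (A)` is coarsely close to `π α (C)` for all `α`. -/
instance limitCoarseProximitySpace : CoarseProximitySpace S.Limit where
  toBornology := S.limitBornology
  near A C := ∀ α, near (S.proj α '' A) (S.proj α '' C)
  symm := fun h α => symm (h α)
  not_isBounded := by
    intro A B h
    rw [limit_isBounded_iff, limit_isBounded_iff]
    exact ⟨fun ⟨α, hα⟩ => (not_isBounded (h α)).1 hα, fun ⟨α, hα⟩ => (not_isBounded (h α)).2 hα⟩
  near_of_inter := by
    intro A B h α
    rw [limit_isBounded_iff] at h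
    exact near_of_inter fun hb => h ⟨α, hb.subset (image_inter_subset _ _ _)⟩
  union_near := by
    intro A B C
    constructor
    · intro h
      by_contra hcon
      simp only [not_or, not_forall] at hcon
      obtain ⟨⟨α, hα⟩, ⟨β, hβ⟩⟩ := hcon
      obtain ⟨γ, hαγ, hβγ⟩ := exists_ge_ge α β
      have h' := h γ
      rw [image_union, union_near] at h'
      exact h'.elim (fun h' => hα (S.near_proj_of_le hαγ h'))
        (fun h' => hβ (S.near_proj_of_le hβγ h'))
    · intro h α
      rw [image_union, union_near]
      exact h.imp (fun h => h α) (fun h => h α)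
  strong := by
    intro A B h
    simp only [not_forall] at h
    obtain ⟨γ, hγ⟩ := h
    obtain ⟨E, hE, hE'⟩ := strong hγ
    refine ⟨S.proj γ ⁻¹' E, fun h => hE ?_, fun h => hE' ?_⟩
    · exact near_mono (h γ) subset_rfl (image_preimage_subset _ _)
    · exact near_mono (h γ) (image_preimage_subset _ Eᶜ) subset_rfl

/-- The projection `π α` as a coarse proximity map. -/
def projMap (α : Ω) : CoarseProximityMap S.Limit (X α) where
  toFun := S.proj α
  isBounded_image := by
    intro B hB
    obtain ⟨β, hβ⟩ := S.limit_isBounded_iff.1 hB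
    exact (S.isBounded_proj_iff β α B).1 hβ
  near_image := fun h => h α

end CoarseInverseSystem

/-!
The inverse of the comparison map is explicit: a compatible family `(σ α)` of boundary clusters
comes from the cluster `{A | π α (A) ∈ σ α for all α}` on the limit. Two members of a boundary
cluster are coarsely close, not merely near for the discrete extension (`near_of_mem_boundary`);
hence two sets all of whose projections lie in the clusters `σ α` are coarsely close in the limit.
For the union axiom, failures at two indices are moved to a common upper bound. For maximality, a
member `D` of `σ α` need not pull back to a member of the cluster on the limit, but every proximity
neighbourhood of `D` does (`preimage_mem_of_mem_mapCluster`), and this is enough because nearness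
can be tested on such neighbourhoods; surjectivity of the projections enters here.

As inclusions between clusters are equalities (`Cluster.eq_of_subset`), functoriality and the
identification of the projections of this cluster reduce to one inclusion each. An induced map
preserves the proximity `δ*`, so it is continuous. Continuity of the inverse holds because sets that
are not close in the limit are already not close at some index `α`, and because the clusters
containing a fixed set form a closed set (`isClosed_setOf_mem`).
-/

/-! ### Clusters and induced maps -/

namespace ProximityRel

variable {X : Type u} {Y : Type v}

theorem Cluster.eq_of_subset {P : ProximityRel X} {σ τ : P.Cluster} (h : σ.sets ⊆ τ.sets) :
    σ = τ :=
  Cluster.ext (h.antisymm fun _ hC =>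
    σ.mem_of_near fun _ hA => τ.near_of_mem hC (h hA))

theorem Cluster.univ_mem {P : ProximityRel X} (σ : P.Cluster) : univ ∈ σ.sets := by
  obtain ⟨B, hB⟩ := σ.nonempty
  exact σ.mem_of_subset hB (subset_univ B)

theorem isClosed_setOf_mem (P : ProximityRel X) (D : Set X) :
    IsClosed {τ : P.Cluster | D ∈ τ.sets} := by
  rw [← isOpen_compl_iff]
  intro τ hτ h
  rw [compl_compl] at h
  exact hτ (τ.mem_of_near fun A hA =>
    P.symm (h A D (fun _ hσ => hσ ▸ hA) fun _ hσ => hσ))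

theorem IsProximityMap.continuous {P : ProximityRel X} {Q : ProximityRel Y} {f : X → Y}
    (hf : IsProximityMap P Q f) : @Continuous _ _ P.topology Q.topology f := by
  let := P.topology
  let := Q.topology
  refine ⟨fun U hU x hx h => hU (f x) hx ?_⟩
  have h' := hf _ _ h
  rw [image_singleton, ← preimage_compl] at h'
  exact Q.mono_right h' (image_preimage_subset f Uᶜ)

variable {P : ProximityRel X} {Q : ProximityRel Y} {f : X → Y}

theorem IsProximityMap.image_mem_mapCluster (hf : IsProximityMap P Q f) {σ : P.Cluster}
    {A : Set X} (hA : A ∈ σ.sets) : f '' A ∈ (hf.mapCluster σ).sets :=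
  fun _ hE => hf _ _ (σ.near_of_mem hA hE)

/-- Members of the induced cluster pull back to members of the original one after being enlarged
to a proximity neighbourhood. -/
theorem IsProximityMap.preimage_mem_of_mem_mapCluster (hf : IsProximityMap P Q f) {σ : P.Cluster}
    {D E : Set Y} (hD : D ∈ (hf.mapCluster σ).sets) (hE : ¬ Q.near D Eᶜ) :
    f ⁻¹' E ∈ σ.sets :=
  (σ.mem_or_compl_mem _).resolve_right fun h =>
    hE (Q.mono_right (hD _ h) (image_preimage_subset f Eᶜ))

theorem IsProximityMap.isProximityMap_mapCluster (hf : IsProximityMap P Q f) :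
    IsProximityMap P.smirnov Q.smirnov hf.mapCluster := by
  intro S T h A B hA hB
  by_contra hAB
  obtain ⟨E, hE, hE'⟩ := Q.strong hAB
  obtain ⟨F, hF, hF'⟩ := Q.strong hE'
  have h1 : P.Absorbs (f ⁻¹' E) S := fun σ hσ =>
    hf.preimage_mem_of_mem_mapCluster (hA _ (mem_image_of_mem _ hσ)) hE
  have h2 : P.Absorbs (f ⁻¹' Fᶜ) T := fun σ hσ =>
    hf.preimage_mem_of_mem_mapCluster (hB _ (mem_image_of_mem _ hσ)) fun h =>
      hF' (Q.symm (by rwa [compl_compl] at h))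
  exact hF (Q.mono_right (Q.mono_left (hf _ _ (h _ _ h1 h2)) (image_preimage_subset _ _))
    (image_preimage_subset _ _))

theorem IsProximityMap.continuous_mapCluster (hf : IsProximityMap P Q f) :
    Continuous hf.mapCluster :=
  hf.isProximityMap_mapCluster.continuous

end ProximityRel

/-! ### Boundaries of coarse proximity spaces -/

/-- Members of a boundary cluster are coarsely close, which is stronger than being near for the
discrete extension. -/
theorem CoarseProximitySpace.near_of_mem_boundary {X : Type u} [CoarseProximitySpace X]
    (σ : Boundary X) {A B : Set X} (hA : A ∈ σ.1.sets) (hB : B ∈ σ.1.sets) : near A B := by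
  by_contra hAB
  have hbdd : IsBounded (A ∩ B) := by
    by_contra h
    exact hAB (near_of_inter h)
  -- Removing the bounded set `A ∩ B` from `A` leaves a member of `σ` disjoint from `B`.
  have hdiff : A \ B ∈ σ.1.sets := by
    rw [← inter_union_sdiff A B] at hA
    exact (σ.1.mem_or_mem hA).resolve_left fun h => σ.2 _ h hbdd
  rcases σ.1.near_of_mem hdiff hB with ⟨x, hx, hxB⟩ | h
  · exact hx.2 hxB
  · exact hAB (near_mono h sdiff_subset subset_rfl)

namespace CoarseProximityMap

variable {X : Type u} {Y : Type v} [CoarseProximitySpace X] [CoarseProximitySpace Y]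

theorem continuous_boundaryMap (f : CoarseProximityMap X Y) : Continuous f.boundaryMap :=
  (f.isProximityMap.continuous_mapCluster.comp continuous_subtype_val).subtype_mk _

theorem image_mem_boundaryMap (f : CoarseProximityMap X Y) {σ : Boundary X} {A : Set X}
    (hA : A ∈ σ.1.sets) : f.toFun '' A ∈ (f.boundaryMap σ).1.sets :=
  f.isProximityMap.image_mem_mapCluster hA

theorem boundaryMap_boundaryMap {W : Type*} [CoarseProximitySpace W] (f : CoarseProximityMap X Y)
    (g : CoarseProximityMap Y W) (h : CoarseProximityMap X W)
    (hgf : ∀ x, g.toFun (f.toFun x) = h.toFun x) (σ : Boundary X) :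
    g.boundaryMap (f.boundaryMap σ) = h.boundaryMap σ := by
  refine Subtype.ext (ProximityRel.Cluster.eq_of_subset fun A hA E hE => ?_)
  have h1 := hA _ (f.image_mem_boundaryMap hE)
  rwa [image_image, image_congr fun x _ => hgf x] at h1

end CoarseProximityMap

/-! ### The boundary of an inverse limit -/

namespace CoarseInverseSystem

variable {Ω : Type u} [PartialOrder Ω] {X : Ω → Type v} [∀ α, CoarseProximitySpace (X α)]
  (S : CoarseInverseSystem Ω X)

theorem proj_image_mem_of_le (s : S.BoundaryLimit) {α β : Ω} (h : α ≤ β) {A : Set S.Limit}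
    (hA : S.proj β '' A ∈ (s.1 β).1.sets) : S.proj α '' A ∈ (s.1 α).1.sets := by
  rcases h.eq_or_lt with rfl | h
  · exact hA
  · rw [← S.map_image_proj h A, ← s.2 α β h]
    exact (S.map h).image_mem_boundaryMap hA

variable [IsDirectedOrder Ω]

/-- A proximity neighbourhood of a member of one cluster of a compatible family pulls back to a
subset of the limit all of whose projections are members of the family's clusters. Indices are
compared at a common upper bound `γ`, where the preimage under `S.map` is a member and surjectivity
identifies it with the projection of the pullback. -/
theorem proj_image_preimage_mem (hsurj : ∀ α, Function.Surjective (S.proj α))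
    (s : S.BoundaryLimit) {α : Ω} {D E : Set (X α)} (hD : D ∈ (s.1 α).1.sets)
    (hDE : ¬ (discreteExtension (X α)).near D Eᶜ) (β : Ω) :
    S.proj β '' (S.proj α ⁻¹' E) ∈ (s.1 β).1.sets := by
  obtain ⟨γ, hα, hβ⟩ := exists_ge_ge α β
  refine S.proj_image_mem_of_le s hβ ?_
  rcases hα.eq_or_lt with rfl | hα
  · rw [image_preimage_eq _ (hsurj α)]
    refine ((s.1 α).1.mem_or_compl_mem E).resolve_right fun h => ?_
    exact hDE ((s.1 α).1.near_of_mem hD h)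
  · have hpre : S.proj α ⁻¹' E = S.proj γ ⁻¹' ((S.map hα).toFun ⁻¹' E) := by
      ext z
      exact iff_of_eq (congrArg (· ∈ E) (z.compat hα).symm)
    rw [hpre, image_preimage_eq _ (hsurj γ)]
    rw [← s.2 α γ hα] at hD
    exact (S.map hα).isProximityMap.preimage_mem_of_mem_mapCluster hD hDE

variable [Nonempty Ω]

/-- The boundary cluster of the limit determined by a compatible family of boundary clusters: it
consists of the sets all of whose projections belong to the given clusters. -/
def limitCluster (hsurj : ∀ α, Function.Surjective (S.proj α)) (s : S.BoundaryLimit) :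
    Boundary S.Limit where
  val :=
    { sets := {A | ∀ α, S.proj α '' A ∈ (s.1 α).1.sets}
      nonempty := ⟨univ, fun α => by
        rw [image_univ_of_surjective (hsurj α)]
        exact (s.1 α).1.univ_mem⟩
      near_of_mem := fun hA hB => Or.inr fun α => near_of_mem_boundary (s.1 α) (hA α) (hB α)
      mem_or_mem := by
        intro A B h
        by_contra hcon
        simp only [not_or, mem_ofPred_eq, not_forall] at hcon
        obtain ⟨⟨α, hα⟩, ⟨β, hβ⟩⟩ := hcon
        obtain ⟨γ, hαγ, hβγ⟩ := exists_ge_ge α β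
        have h' := h γ
        rw [image_union] at h'
        exact ((s.1 γ).1.mem_or_mem h').elim
          (fun h' => hα (S.proj_image_mem_of_le s hαγ h'))
          (fun h' => hβ (S.proj_image_mem_of_le s hβγ h'))
      mem_of_near := by
        intro C hC α
        refine (s.1 α).1.mem_of_near fun D hD => ?_
        by_contra hCD
        obtain ⟨E, hE, hE'⟩ := (discreteExtension (X α)).strong fun h =>
          hCD ((discreteExtension (X α)).symm h)
        -- `E` is a proximity neighbourhood of `D` that is not near the projection of `C`.
        have hCE := (S.projMap α).isProximityMap _ _
          (hC _ fun β => S.proj_image_preimage_mem hsurj s hD hE β)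
        exact hE' ((discreteExtension (X α)).symm
          ((discreteExtension (X α)).mono_right hCE (image_preimage_subset _ _))) }
  property := by
    intro B hB hbdd
    obtain ⟨α, hα⟩ := S.limit_isBounded_iff.1 hbdd
    exact (s.1 α).2 _ (hB α) hα

theorem boundaryMap_projMap_limitCluster (hsurj : ∀ α, Function.Surjective (S.proj α))
    (s : S.BoundaryLimit) (α : Ω) :
    (S.projMap α).boundaryMap (S.limitCluster hsurj s) = s.1 α := by
  symm
  exact Subtype.ext (ProximityRel.Cluster.eq_of_subset fun _ hD _ hE =>
    (s.1 α).1.near_of_mem hD (hE α))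

/-- The comparison map from the boundary of the limit to the limit of the boundaries. -/
def boundaryToLimit (σ : Boundary S.Limit) : S.BoundaryLimit :=
  ⟨fun α => (S.projMap α).boundaryMap σ, fun _ _ h =>
    CoarseProximityMap.boundaryMap_boundaryMap _ _ _ (fun z => z.compat h) σ⟩

theorem limitCluster_boundaryToLimit (hsurj : ∀ α, Function.Surjective (S.proj α))
    (σ : Boundary S.Limit) : S.limitCluster hsurj (S.boundaryToLimit σ) = σ := by
  symm
  exact Subtype.ext (ProximityRel.Cluster.eq_of_subset fun _ hA α =>
    (S.projMap α).image_mem_boundaryMap hA)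

theorem continuous_boundaryToLimit : Continuous S.boundaryToLimit :=
  (continuous_pi fun α => (S.projMap α).continuous_boundaryMap).subtype_mk _

theorem continuous_limitCluster (hsurj : ∀ α, Function.Surjective (S.proj α)) :
    Continuous (S.limitCluster hsurj) := by
  refine continuous_induced_rng.2 ⟨fun U hU => isOpen_iff_mem_nhds.2 fun s hs => ?_⟩
  -- The cluster of `s` is separated from `Uᶜ` by sets `A` and `B`, which are not coarsely close.
  have h := hU _ hs
  change ¬ ∀ A B, _ → _ → _ at h
  simp only [not_forall] at h
  obtain ⟨A, B, hA, hB, hAB⟩ := h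
  have hAB' : ¬ ∀ α, near (S.proj α '' A) (S.proj α '' B) := fun h => hAB (Or.inr h)
  rw [not_forall] at hAB'
  obtain ⟨α, hα⟩ := hAB'
  have hopen : IsOpen {t : S.BoundaryLimit | S.proj α '' B ∉ (t.1 α).1.sets} :=
    (ProximityRel.isClosed_setOf_mem _ (S.proj α '' B)).isOpen_compl.preimage
      (continuous_subtype_val.comp ((continuous_apply α).comp continuous_subtype_val))
  refine Filter.mem_of_superset (hopen.mem_nhds fun h => hα ?_) fun t ht => ?_
  · exact near_of_mem_boundary (s.1 α) (hA _ rfl α) h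
  · by_contra htU
    exact ht (hB _ htU α)

/-- The comparison map as a homeomorphism, with `limitCluster` as its inverse. -/
def boundaryLimitHomeomorph (hsurj : ∀ α, Function.Surjective (S.proj α)) :
    Boundary S.Limit ≃ₜ S.BoundaryLimit where
  toFun := S.boundaryToLimit
  invFun := S.limitCluster hsurj
  left_inv := S.limitCluster_boundaryToLimit hsurj
  right_inv s := Subtype.ext (funext fun α => S.boundaryMap_projMap_limitCluster hsurj s α)
  continuous_toFun := S.continuous_boundaryToLimit
  continuous_invFun := S.continuous_limitCluster hsurj

end CoarseInverseSystem

theorem mainTheorem4 {Ω : Type u} [PartialOrder Ω] [IsDirectedOrder Ω] [Nonempty Ω]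
    {X : Ω → Type v} [∀ α, CoarseProximitySpace (X α)] (S : CoarseInverseSystem Ω X)
    (hsurj : ∀ α, Function.Surjective (S.proj α)) :
    -- the boundaries form an inverse system of topological spaces
    (∀ (α β : Ω) (h : α < β), Continuous (S.map h).boundaryMap) ∧
    (∀ (α β γ : Ω) (hαβ : α < β) (hβγ : β < γ) (σ : CoarseProximitySpace.Boundary (X γ)),
      (S.map hαβ).boundaryMap ((S.map hβγ).boundaryMap σ) =
        (S.map (hαβ.trans hβγ)).boundaryMap σ) ∧
    -- and the boundary of the limit, with the maps `𝓤(π α)`, is its inverse limit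
    ∃ Φ : CoarseProximitySpace.Boundary S.Limit ≃ₜ S.BoundaryLimit,
      ∀ (σ : CoarseProximitySpace.Boundary S.Limit) (α : Ω),
        (Φ σ).1 α = (S.projMap α).boundaryMap σ := by
  exact ⟨fun _ _ h => (S.map h).continuous_boundaryMap,
    fun _ _ _ hαβ hβγ σ =>
      CoarseProximityMap.boundaryMap_boundaryMap _ _ _ (S.map_comp hαβ hβγ) σ,
    S.boundaryLimitHomeomorph hsurj, fun _ _ => rfl⟩
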